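/- Let $(\Omega,\mathcal F,\mathbb P)$ be a probability space ($\mathcal F$ being the $\sigma$-algebra of the information available at the fixed time $t$), and write $L^2(\mathcal F)$ for the space of real square-integrable random variables. **Setting.** A proper convex risk-measure is a function $\rho:L^2(\mathcal F)\to(-\infty,\infty]$, finite at some point, convex, with $\rho(Y)\le\rho(X)$ whenever $X\le Y$ a.s., and $\rho(X+k)=\rho(X)-k$ for $k\in\mathbb R$; its acceptance set is $\mathscr A_\rho=\{Z:\rho(Z)\le 0\}$. A risk-perspective is a quintuple $\mathcal R=(\mathcal G,\rho,\mathfrak u,\Phi,M)$ consisting of a sub-$\sigma$-algebra $\mathcal G\subseteq\mathcal F$; a proper convex risk-measure $\rho$ with $\mathscr A_\rho$ non-empty and closed; a map $\mathfrak u:L^2(\mathcal F)\to L^2(\mathcal F)$ such that $\rho_{\mathfrak u}:=\rho\circ\mathfrak u$ is proper, convex and lower semi-continuous with $\inf_{Z\in L^2(\mathcal G)}\rho_{\mathfrak u}(Z)>-\infty$; a non-empty, closed, convex set $\Phi\subseteq L^2(\mathcal F)$ with $L^2(\mathcal G)\cap\Phi\cap\mathscr A_\rho\cap\operatorname{dom}\rho_{\mathfrak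 u}\ne\emptyset$; and $M\in(0,\infty]$. Fix $\lambda\in[0,1)$, put $C:=L^2(\mathcal G)\cap\Phi$ and $$f(Y):=(1-\lambda)\,\mathbb E[|Y|^2]+\lambda\,\rho_{\mathfrak u}(Y)\qquad(Y\in L^2(\mathcal F),\ 0\cdot\infty:=0),$$ and let $\iota_C$ be $0$ on $C$ and $+\infty$ off $C$. For $X\in L^2(\mathcal F)$ let $\mathcal R(X)$ denote any minimiser of $Z\mapsto f(X-Z)$ over $Z\in C$. For $A\subseteq L^2(\mathcal F)$ let $\operatorname{sri}(A)=\{x\in A:\operatorname{cone}(A-x)=\overline{\operatorname{span}}(A-x)\}$, where $\operatorname{cone}$ denotes the smallest convex cone containing a set. Let $f^\star(Z)=\sup_{Y\in L^2(\mathcal F)}\{\mathbb E[ZY]-f(Y)\}$ be the convex conjugate and $\sigma_C(Z)=\sup_{Y\in C}\mathbb E[ZY]$ the support function. **Proposition (Robust Representation).** Let $X_t\in L^2(\mathcal F)$ with $X_t\neq0$ $\mathbb P$-a.s., and suppose that $$0\in\operatorname{sri}\bigl(\operatorname{dom} f+\operatorname{dom}\iota_C\bigr).$$ Then a minimiser $\mathcal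 R(X_t)$ exists, and for each such minimiser the optimal value $$\rho_{\lambda,t}:=(1-\lambda)\,\mathbb E\bigl[|X_t-\mathcal R(X_t)|^2\bigr]+\lambda\,\rho_{\mathfrak u}\bigl(X_t-\mathcal R(X_t)\bigr)$$ equals the infimal convolution $(f\,\square\,\iota_C)(X_t)=\inf_{Z\in L^2(\mathcal F)}\{f(X_t-Z)+\iota_C(Z)\}$ and has the robust representation (an identity in $[-\infty,\infty]$) $$\rho_{\lambda,t}=\sup_{\tilde X_t\in\mathcal M_{alt}(X_t)}\Bigl(\mathbb E[\tilde X_t]-\alpha\bigl(\tilde X_t/X_t\bigr)\Bigr),\qquad \alpha(Z):=f^\star(Z)+\sigma_C(Z),$$ where $\mathcal M_{alt}(X_t)=\{\,YX_t: Y\in L^2(\mathcal F)\,\}$ is the set of alternative models. -/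

import Mathlib

open MeasureTheory
open scoped Pointwise

noncomputable section

namespace RobustRep

/-! ### Convex analysis in a real normed space, extended-real-valued functions -/

section ConvexAnalysis

variable {E : Type*} [NormedAddCommGroup E] [NormedSpace ℝ E]

/-- A proper function: it never takes the value `-∞` and is finite somewhere. -/
def IsProper (f : E → EReal) : Prop :=
  (∀ x, f x ≠ ⊥) ∧ ∃ x, f x ≠ ⊤

/-- Convexity of a function with values in `(-∞, ∞]`. -/
def IsConvex (f : E → EReal) : Prop :=
  ∀ (x y : E) (a : ℝ), 0 ≤ a → a ≤ 1 →
    f (a • x + (1 - a) • y) ≤ (a : EReal) * f x + ((1 - a : ℝ) : EReal) * f y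

/-- The effective domain. -/
def dom (f : E → EReal) : Set E := {x | f x < ⊤}

open Classical in
/-- The indicator function of convex analysis: `0` on `C` and `∞` off `C`. -/
def indicatorFn (C : Set E) (x : E) : EReal := if x ∈ C then 0 else ⊤

/-- The infimal convolution `f □ g`. -/
def infConv (f g : E → EReal) (x : E) : EReal := ⨅ z : E, f (x - z) + g z

/-- The strong relative interior: the points `x ∈ C` for which the smallest convex cone
containing `C - x` is the closed linear span of `C - x`. -/
def sri (C : Set E) : Set E :=
  {x | x ∈ C ∧
    (ConvexCone.hull ℝ ((fun y => y - x) '' C) : Set E) =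
      closure (Submodule.span ℝ ((fun y => y - x) '' C) : Set E)}

end ConvexAnalysis

section Probability

/-- The subspace `L²(𝒢)` of `L²(ℱ)`, as a set of (classes of) real random variables. -/
def L2Sub {Ω : Type*} (G : MeasurableSpace Ω) {mΩ : MeasurableSpace Ω} (P : Measure Ω) :
    Set (Lp ℝ 2 P) :=
  (lpMeas ℝ ℝ G 2 P : Set (Lp ℝ 2 P))

variable {Ω : Type*} [mΩ : MeasurableSpace Ω]

/-- The Fenchel conjugate `f⋆(Z) = sup_Y E[ZY] - f(Y)` on `L²`. -/
def conj {P : Measure Ω} (f : Lp ℝ 2 P → EReal) (Z : Lp ℝ 2 P) : EReal :=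
  ⨆ Y : Lp ℝ 2 P, ((∫ ω, Z ω * Y ω ∂P : ℝ) : EReal) - f Y

/-- The support function `σ_C(Z) = sup {E[ZY] : Y ∈ C}`. -/
def supportFn {P : Measure Ω} (C : Set (Lp ℝ 2 P)) (Z : Lp ℝ 2 P) : EReal :=
  ⨆ Y ∈ C, ((∫ ω, Z ω * Y ω ∂P : ℝ) : EReal)

/-- Proper convex risk-measures on `L²`, with values in `(-∞, ∞]`. -/
structure IsConvexRiskMeasure (P : Measure Ω) [IsFiniteMeasure P]
    (ρ : Lp ℝ 2 P → EReal) : Prop where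
  antitone : ∀ X Y : Lp ℝ 2 P, X ≤ Y → ρ Y ≤ ρ X
  cash_invariant : ∀ (X : Lp ℝ 2 P) (k : ℝ), ρ (X + Lp.const 2 P k) = ρ X - (k : EReal)
  convex : IsConvex ρ
  proper : IsProper ρ

/-- A risk-perspective `(𝒢, ρ, u, Φ, M)`. -/
structure RiskPerspective (P : Measure Ω) [IsFiniteMeasure P] where
  /-- the sub-σ-algebra `𝒢` -/
  G : {m : MeasurableSpace Ω // m ≤ mΩ}
  /-- the risk-measure -/
  ρ : Lp ℝ 2 P → EReal
  riskMeasure : IsConvexRiskMeasure P ρ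
  acceptance_nonempty : {Z : Lp ℝ 2 P | ρ Z ≤ 0}.Nonempty
  acceptance_closed : IsClosed {Z : Lp ℝ 2 P | ρ Z ≤ 0}
  /-- the utility operator -/
  u : Lp ℝ 2 P → Lp ℝ 2 P
  utility_proper : IsProper (fun Z => ρ (u Z))
  utility_convex : IsConvex (fun Z => ρ (u Z))
  utility_lsc : LowerSemicontinuous (fun Z => ρ (u Z))
  utility_bddBelow : ⊥ < ⨅ Z ∈ L2Sub G.1 P, ρ (u Z)
  /-- the feature set -/
  Φ : Set (Lp ℝ 2 P)
  feature_nonempty : Φ.Nonempty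
  feature_convex : Convex ℝ Φ
  feature_closed : IsClosed Φ
  feasible : (L2Sub G.1 P ∩ Φ ∩ {Z : Lp ℝ 2 P | ρ Z ≤ 0} ∩ dom (fun Z => ρ (u Z))).Nonempty
  /-- the risk-aversion level -/
  M : EReal
  M_pos : 0 < M

namespace RiskPerspective

variable {P : Measure Ω} [IsFiniteMeasure P] (R : RiskPerspective P)

/-- The set of admissible estimators `L²(𝒢) ∩ Φ`. -/
def estimators : Set (Lp ℝ 2 P) := L2Sub R.G.1 P ∩ R.Φ

/-- The loss `Y ↦ (1 - lam) E[Y²] + lam ρ(u(Y))`, with the convention `0 · ∞ = 0`. -/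
def loss (lam : ℝ) (Y : Lp ℝ 2 P) : EReal :=
  (((1 - lam) * ∫ ω, ‖Y ω‖ ^ 2 ∂P : ℝ) : EReal) + (lam : EReal) * R.ρ (R.u Y)

/-- `Z` is a value at `X` of the conditioning operator of `R` with parameter `lam`: it belongs to
`L²(𝒢) ∩ Φ` and minimises the loss of `X - Z` there. -/
def IsConditioning (lam : ℝ) (X Z : Lp ℝ 2 P) : Prop :=
  Z ∈ R.estimators ∧ ∀ W ∈ R.estimators, R.loss lam (X - Z) ≤ R.loss lam (X - W)

/-- The penalty `α = (loss)⋆ + σ_{L²(𝒢) ∩ Φ}`. -/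
def penalty (lam : ℝ) (Z : Lp ℝ 2 P) : EReal :=
  conj (R.loss lam) Z + supportFn R.estimators Z

end RiskPerspective

/-- The alternative models of `X`: the random variables `Y X` with `Y ∈ L²`. -/
def altModels {P : Measure Ω} (X : Lp ℝ 2 P) : Set (Ω → ℝ) :=
  {V | ∃ Y : Lp ℝ 2 P, V =ᵐ[P] fun ω => Y ω * X ω}

theorem altModels.memLp_ratio {P : Measure Ω} {X : Lp ℝ 2 P} {V : Ω → ℝ}
    (hV : V ∈ altModels X) : MemLp (fun ω => V ω / X ω) 2 P := by
  obtain ⟨Y, hY⟩ := hV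
  have hX : AEMeasurable X P := (Lp.aestronglyMeasurable X).aemeasurable
  have hVm : AEMeasurable V P :=
    ((Lp.aestronglyMeasurable Y).aemeasurable.mul hX).congr hY.symm
  refine (Lp.memLp Y).mono (hVm.div hX).aestronglyMeasurable ?_
  filter_upwards [hY] with ω hω
  rw [hω]
  by_cases h : X ω = 0
  · simp [h]
  · rw [mul_div_assoc, div_self h, mul_one]

/-- The ratio `V / X`, an element of `L²`, for an alternative model `V` of `X`. -/
def altModels.ratio {P : Measure Ω} {X : Lp ℝ 2 P} (V : altModels X) : Lp ℝ 2 P :=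
  (altModels.memLp_ratio V.2).toLp

end Probability

end RobustRep

end

open RobustRep

open Filter
open scoped Topology

/-! The loss `f` is `(1 - lam) ‖·‖²` plus a nonnegative multiple of a proper, convex, lower
semicontinuous function. Since `lam < 1`, it is strongly convex, and the quadratic term makes it
bounded below. Existence and duality both follow from one fact, `isClosed_sumEpigraph`: the set `epi
f + C × {0}` is closed. A sum of closed convex sets need not be closed, and strong convexity
replaces compactness here.

Over each point the fibre of this set is a closed half-line, possibly empty, whose lowest point
gives a minimiser (`exists_minimizer`). A point strictly below the set is separated from it by a
non-vertical hyperplane (`exists_affine_minorant`). By Riesz its slope is some `Y` in `L²`, whose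
dual value exceeds the height of that point. With Fenchel–Young for the other inequality this is
`infConv_eq_iSup`. Because `Xt` is a.s. nonzero, `iSup_altModels` rewrites the supremum over `Y` as
one over alternative models. -/

namespace RobustRep

/-! ### Affine minorants of closed convex epigraphs -/

section AffineMinorant

variable {E : Type*} [NormedAddCommGroup E] [NormedSpace ℝ E]

/-- A hyperplane that strictly separates a point from an epigraph-like set and is not vertical is
the graph of an affine minorant. -/
theorem exists_affine_minorant_of_separation {S : Set (E × ℝ)} {x : E} {c u β : ℝ}
    {η : E →L[ℝ] ℝ} (hβ : 0 < β) (hx : η x + β * c < u)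
    (hS : ∀ p ∈ S, u < η p.1 + β * p.2) :
    ∃ (φ : E →L[ℝ] ℝ) (b : ℝ), (∀ p ∈ S, φ p.1 + b ≤ p.2) ∧ c < φ x + b := by
  refine ⟨-(β⁻¹ • η), β⁻¹ * u, fun p hp => ?_, ?_⟩
  · have := hS p hp
    have h : β⁻¹ * u < β⁻¹ * (η p.1 + β * p.2) := by gcongr
    rw [mul_add, inv_mul_cancel_left₀ hβ.ne'] at h
    simp only [neg_apply, smul_apply, smul_eq_mul]
    linarith
  · have h : β⁻¹ * (η x + β * c) < β⁻¹ * u := by gcongr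
    rw [mul_add, inv_mul_cancel_left₀ hβ.ne'] at h
    simp only [neg_apply, smul_apply, smul_eq_mul]
    linarith

/-- Points below a closed convex epigraph lie below one of its affine minorants. -/
theorem exists_affine_minorant {S : Set (E × ℝ)} (hconv : Convex ℝ S) (hclosed : IsClosed S)
    (hup : ∀ x r s, (x, r) ∈ S → r ≤ s → (x, s) ∈ S)
    {x₀ : E} {r₀ c₀ : ℝ} (h₀ : (x₀, r₀) ∈ S) (hc₀ : (x₀, c₀) ∉ S)
    {x : E} {c : ℝ} (hx : (x, c) ∉ S) :
    ∃ (φ : E →L[ℝ] ℝ) (b : ℝ), (∀ p ∈ S, φ p.1 + b ≤ p.2) ∧ c < φ x + b := by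
  have sep : ∀ {y : E} {d : ℝ}, (y, d) ∉ S → ∃ (η : E →L[ℝ] ℝ) (β u : ℝ),
      η y + β * d < u ∧ ∀ p ∈ S, u < η p.1 + β * p.2 := by
    intro y d hy
    obtain ⟨ψ, u, h1, h2⟩ := geometric_hahn_banach_point_closed hconv hclosed hy
    have key : ∀ p : E × ℝ, ψ p = ψ.comp (ContinuousLinearMap.inl ℝ E ℝ) p.1 + ψ (0, 1) * p.2 := by
      rintro ⟨z, r⟩
      have : ((z, r) : E × ℝ) = (z, 0) + r • (0, 1) := by simp
      rw [this, map_add, map_smul]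
      simp [mul_comm]
    refine ⟨ψ.comp (ContinuousLinearMap.inl ℝ E ℝ), ψ (0, 1), u, ?_, fun p hp => ?_⟩
    · rw [key] at h1; exact h1
    · rw [← key]; exact h2 p hp
  have hlt : c₀ < r₀ := lt_of_not_ge fun h => hc₀ (hup _ _ _ h₀ h)
  obtain ⟨φ₀, b₀, hφ₀, -⟩ : ∃ (φ : E →L[ℝ] ℝ) (b : ℝ),
      (∀ p ∈ S, φ p.1 + b ≤ p.2) ∧ c₀ < φ x₀ + b := by
    obtain ⟨η, β, u, h1, h2⟩ := sep hc₀
    refine exists_affine_minorant_of_separation ?_ h1 h2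
    -- The separated points `(x₀, c₀)` and `(x₀, r₀)` share a vertical line, which forces `β > 0`.
    have := h2 _ h₀
    simp only at this
    nlinarith
  obtain ⟨η, β, u, h1, h2⟩ := sep hx
  have hβ : 0 ≤ β := by
    by_contra! hneg
    -- The chosen height is where `η x₀ + β * r` would equal `u`; for `β < 0` it lies above `r₀`,
    -- hence in `S`.
    have h3 := h2 _ (hup _ _ (r₀ + (u - (η x₀ + β * r₀)) / β) h₀
      (le_add_of_nonneg_right (div_nonneg_of_nonpos (by linarith [h2 _ h₀]) hneg.le)))
    simp only [mul_add, mul_div_cancel₀ _ hneg.ne] at h3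
    linarith
  rcases hβ.eq_or_lt with rfl | hβ
  -- A vertical hyperplane is no minorant, but `u - η` is negative over `S` and positive at `x`.
  -- Adding a large multiple of it to the minorant `φ₀ + b₀` keeps a minorant and lifts it above `c`
  -- at `x`.
  · simp only [zero_mul, add_zero] at h1 h2
    obtain ⟨n, hn⟩ := exists_nat_gt ((c - (φ₀ x + b₀)) / (u - η x))
    rw [div_lt_iff₀ (by linarith)] at hn
    refine ⟨φ₀ - (n : ℝ) • η, b₀ + n * u, fun p hp => ?_, ?_⟩
    · have h3 : 0 ≤ (n : ℝ) * (η p.1 - u) := mul_nonneg n.cast_nonneg (by linarith [h2 p hp])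
      have h4 := hφ₀ p hp
      simp only [sub_apply, smul_apply, smul_eq_mul]
      linarith
    · simp only [sub_apply, smul_apply, smul_eq_mul]
      linarith
  · exact exists_affine_minorant_of_separation hβ h1 h2

end AffineMinorant

/-! ### The sum epigraph: closedness and existence of minimisers -/

section SumEpigraph

variable {E : Type*} [NormedAddCommGroup E]

/-- The set of `(x, r)` such that `f y ≤ r` for some `y ∈ x - C`; it is the epigraph of
`f □ ι_C` when the infimum is attained. -/
def sumEpigraph (f : E → EReal) (C : Set E) : Set (E × ℝ) :=
  {p | ∃ y, p.1 - y ∈ C ∧ f y ≤ p.2}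

variable {f : E → EReal} {C : Set E}

theorem sumEpigraph_mono {x : E} {r s : ℝ} (h : (x, r) ∈ sumEpigraph f C) (hrs : r ≤ s) :
    (x, s) ∈ sumEpigraph f C := by
  obtain ⟨y, h1, h2⟩ := h
  exact ⟨y, h1, h2.trans (by exact_mod_cast hrs)⟩

theorem infConv_indicatorFn (hf : ∀ y, f y ≠ ⊥) (x : E) :
    infConv f (indicatorFn C) x = ⨅ z ∈ C, f (x - z) := by
  refine iInf_congr fun z => ?_
  by_cases hz : z ∈ C
  · simp [indicatorFn, hz]
  -- In `EReal`, `⊥ + ⊤ = ⊥`, so points off `C` drop out only because `f` avoids `⊥`.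
  · simp [indicatorFn, hz, EReal.add_top_of_ne_bot (hf _)]

theorem infConv_eq_of_isMinimizer (hf : ∀ y, f y ≠ ⊥) {x z : E} (hz : z ∈ C)
    (hmin : ∀ w ∈ C, f (x - z) ≤ f (x - w)) :
    f (x - z) = infConv f (indicatorFn C) x := by
  rw [infConv_indicatorFn hf]
  exact le_antisymm (le_iInf₂ hmin) (iInf₂_le z hz)

/-- A closed sum epigraph that is bounded below yields minimisers of `z ↦ f (x - z)` on `C`. -/
theorem exists_minimizer (hclosed : IsClosed (sumEpigraph f C)) {B : ℝ}
    (hB : ∀ y, (B : EReal) ≤ f y) (hC : C.Nonempty) (x : E) :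
    ∃ z ∈ C, ∀ w ∈ C, f (x - z) ≤ f (x - w) := by
  set T : Set ℝ := {s | (x, s) ∈ sumEpigraph f C} with hT
  rcases T.eq_empty_or_nonempty with hempty | hne
  -- Here `f (x - w) = ⊤` for every `w ∈ C`, so any point of `C` minimises.
  · obtain ⟨z, hz⟩ := hC
    refine ⟨z, hz, fun w hw => ?_⟩
    rw [← EReal.le_of_forall_lt_iff_le]
    intro s hs
    have : s ∈ T := ⟨x - w, by simpa using hw, hs.le⟩
    simp [hempty] at this
  · have hT_closed : IsClosed T := hclosed.preimage (by fun_prop : Continuous fun s : ℝ => (x, s))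
    have hT_bdd : BddBelow T := by
      refine ⟨B, fun s hs => ?_⟩
      obtain ⟨y, -, hy⟩ := hs
      exact_mod_cast (hB y).trans hy
    obtain ⟨y, hyC, hy⟩ := hT_closed.csInf_mem hne hT_bdd
    refine ⟨x - y, hyC, fun w hw => ?_⟩
    rw [← EReal.le_of_forall_lt_iff_le]
    intro s hs
    have hs' : s ∈ T := ⟨x - w, by simpa using hw, hs.le⟩
    rw [sub_sub_cancel]
    exact hy.trans (by exact_mod_cast csInf_le hT_bdd hs')

variable [NormedSpace ℝ E] {a : ℝ}

/-- Strong convexity with modulus `a`, in terms of real upper bounds of the values. -/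
def IsStronglyConvex (a : ℝ) (f : E → EReal) : Prop :=
  ∀ (x y : E) (r s t : ℝ), 0 ≤ t → t ≤ 1 → f x ≤ r → f y ≤ s →
    f (t • x + (1 - t) • y) ≤ (t * r + (1 - t) * s - a * (t * (1 - t)) * ‖x - y‖ ^ 2 : ℝ)

theorem convex_sumEpigraph (ha : 0 ≤ a) (hf : IsStronglyConvex a f) (hC : Convex ℝ C) :
    Convex ℝ (sumEpigraph f C) := by
  rintro ⟨x, r⟩ ⟨y, hy, hfy⟩ ⟨x', r'⟩ ⟨y', hy', hfy'⟩ s t hs ht hst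
  obtain rfl : t = 1 - s := by linarith
  refine ⟨s • y + (1 - s) • y', ?_, (hf y y' r r' s hs (by linarith) hfy hfy').trans ?_⟩
  · convert hC hy hy' hs ht hst using 1
    simp only [Prod.fst_add, Prod.smul_fst, smul_sub]
    abel
  · have : 0 ≤ a * (s * (1 - s)) * ‖y - y'‖ ^ 2 := by positivity
    simp only [Prod.snd_add, Prod.smul_snd, smul_eq_mul]
    exact_mod_cast (by linarith)

/-- Approximate the lowest point `(x, m)` of the closure above `x`. Strong convexity makes the
approximating `y n` Cauchy, and their limit witnesses `(x, m)`; every higher point then follows by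
monotonicity. -/
theorem isClosed_sumEpigraph [CompleteSpace E] (ha : 0 < a) (hf : IsStronglyConvex a f)
    (hf_closed : IsClosed {p : E × ℝ | f p.1 ≤ p.2}) {B : ℝ} (hB : ∀ y, (B : EReal) ≤ f y)
    (hC : Convex ℝ C) (hC_closed : IsClosed C) : IsClosed (sumEpigraph f C) := by
  set S := sumEpigraph f C with hS
  refine isClosed_of_closure_subset ?_
  rintro ⟨x, r⟩ hxr
  set T : Set ℝ := {s | (x, s) ∈ closure S} with hT
  have hT_closed : IsClosed T := isClosed_closure.preimage (by fun_prop : Continuous fun s : ℝ => (x, s))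
  have hT_bdd : BddBelow T := by
    refine ⟨B, fun s hs => ?_⟩
    have hsub : closure S ⊆ {p : E × ℝ | B ≤ p.2} := by
      refine closure_minimal ?_ (isClosed_le continuous_const continuous_snd)
      rintro p ⟨y, -, hy⟩
      exact_mod_cast (hB y).trans hy
    exact hsub hs
  set m := sInf T with hm
  have hmT : (x, m) ∈ closure S := hT_closed.csInf_mem ⟨r, hxr⟩ hT_bdd
  have hmr : m ≤ r := csInf_le hT_bdd hxr
  obtain ⟨p, hpS, hp⟩ := mem_closure_iff_seq_limit.1 hmT
  choose y hyC hfy using hpS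
  have hp1 : Tendsto (fun n => (p n).1) atTop (𝓝 x) := (continuous_fst.tendsto _).comp hp
  have hp2 : Tendsto (fun n => (p n).2) atTop (𝓝 m) := (continuous_snd.tendsto _).comp hp
  have hcauchy : CauchySeq y := by
    by_contra hnot
    rw [Metric.cauchySeq_iff] at hnot
    push Not at hnot
    obtain ⟨ε, hε, hnot⟩ := hnot
    choose i hi j hj hij using hnot
    have hi' : Tendsto i atTop atTop := tendsto_atTop_mono hi tendsto_id
    have hj' : Tendsto j atTop atTop := tendsto_atTop_mono hj tendsto_id
    -- Midpoints of pairs at distance at least `ε` gain `a * (1/2) * (1/2) * ε ^ 2` in height, so in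
    -- the limit the closure would reach below `m`.
    have hmem : (x, m - a / 4 * ε ^ 2) ∈ closure S := by
      have hlim : Tendsto (fun n => ((1 / 2 : ℝ) • (p (i n)).1 + (1 - 1 / 2 : ℝ) • (p (j n)).1,
          (1 / 2 : ℝ) * (p (i n)).2 + (1 - 1 / 2) * (p (j n)).2 - a / 4 * ε ^ 2)) atTop
          (𝓝 (x, m - a / 4 * ε ^ 2)) := by
        refine Tendsto.prodMk_nhds ?_ ?_
        · have h := ((hp1.comp hi').const_smul (1 / 2 : ℝ)).add
            ((hp1.comp hj').const_smul (1 - 1 / 2 : ℝ))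
          rwa [← add_smul, add_sub_cancel, one_smul] at h
        · have h := (((hp2.comp hi').const_mul (1 / 2 : ℝ)).add
            ((hp2.comp hj').const_mul (1 - 1 / 2 : ℝ))).sub_const (a / 4 * ε ^ 2)
          rwa [← add_mul, add_sub_cancel, one_mul] at h
      refine mem_closure_of_tendsto hlim (Eventually.of_forall fun n => ?_)
      refine ⟨(1 / 2 : ℝ) • y (i n) + (1 - 1 / 2 : ℝ) • y (j n), ?_, ?_⟩
      · convert hC (hyC (i n)) (hyC (j n)) (by norm_num : (0 : ℝ) ≤ 1 / 2)
          (by norm_num : (0 : ℝ) ≤ 1 - 1 / 2) (by norm_num) using 1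
        simp only [smul_sub]
        abel
      · refine (hf _ _ _ _ (1 / 2) (by norm_num) (by norm_num) (hfy (i n)) (hfy (j n))).trans ?_
        have h1 : ε ^ 2 ≤ ‖y (i n) - y (j n)‖ ^ 2 := by
          gcongr
          rw [← dist_eq_norm]
          exact hij n
        have h2 : a / 4 * ε ^ 2 ≤ a / 4 * ‖y (i n) - y (j n)‖ ^ 2 := by gcongr
        exact_mod_cast (by linarith)
    have h1 : m ≤ m - a / 4 * ε ^ 2 := csInf_le hT_bdd hmem
    have h2 : 0 < a / 4 * ε ^ 2 := by positivity
    linarith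
  obtain ⟨z, hz⟩ := cauchySeq_tendsto_of_complete hcauchy
  refine sumEpigraph_mono (r := m) ⟨z, ?_, ?_⟩ hmr
  · exact hC_closed.mem_of_tendsto (hp1.sub hz) (Eventually.of_forall hyC)
  · exact hf_closed.mem_of_tendsto (hz.prodMk_nhds hp2) (Eventually.of_forall hfy)

end SumEpigraph

/-! ### Quadratic regularisation of a convex function -/

section QuadraticRegularization

variable {E : Type*} [NormedAddCommGroup E]

/-- The function `a ‖·‖² + l g`. -/
noncomputable def quadReg (a l : ℝ) (g : E → EReal) (y : E) : EReal :=
  ((a * ‖y‖ ^ 2 : ℝ) : EReal) + (l : EReal) * g y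

variable {a l : ℝ} {g : E → EReal}

theorem quadReg_zero_le_iff {y : E} {r : ℝ} : quadReg a 0 g y ≤ r ↔ a * ‖y‖ ^ 2 ≤ r := by
  simp only [quadReg, EReal.coe_zero, zero_mul, add_zero]
  exact EReal.coe_le_coe_iff

/-- For `l > 0` the epigraph is the preimage of that of `g` under a continuous map. The case `l = 0`
stands apart, since `0 * ⊤ = 0` removes `g`. -/
theorem quadReg_le_iff (hl : 0 < l) (hg : ∀ y, g y ≠ ⊥) {y : E} {r : ℝ} :
    quadReg a l g y ≤ r ↔ g y ≤ ((r - a * ‖y‖ ^ 2) / l : ℝ) := by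
  unfold quadReg
  induction h : g y with
  | bot => exact absurd h (hg y)
  | top =>
    rw [EReal.coe_mul_top_of_pos hl, EReal.coe_add_top]
    simp
  | coe v =>
    norm_cast
    rw [le_div_iff₀ hl]
    constructor <;> intro _ <;> linarith

theorem isClosed_epigraph_of_lowerSemicontinuous (hg : LowerSemicontinuous g) :
    IsClosed {p : E × ℝ | g p.1 ≤ p.2} :=
  hg.isClosed_epigraph.preimage (f := fun p : E × ℝ => (p.1, (p.2 : EReal)))
    (continuous_fst.prodMk (continuous_coe_real_ereal.comp continuous_snd))

theorem exists_quadReg_le (hg : IsProper g) : ∃ (y : E) (r : ℝ), quadReg a l g y ≤ r := by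
  obtain ⟨hbot, y, hy⟩ := hg
  lift g y to ℝ using ⟨hy, hbot y⟩ with v hv
  exact ⟨y, a * ‖y‖ ^ 2 + l * v, by simp [quadReg, ← hv]⟩

theorem isClosed_epigraph_quadReg (hl : 0 ≤ l) (hg : ∀ y, g y ≠ ⊥)
    (hg_lsc : LowerSemicontinuous g) : IsClosed {p : E × ℝ | quadReg a l g p.1 ≤ p.2} := by
  rcases hl.eq_or_lt with rfl | hl
  · simp only [quadReg_zero_le_iff]
    exact isClosed_le (by fun_prop) (by fun_prop)
  · simp only [quadReg_le_iff hl hg]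
    exact (isClosed_epigraph_of_lowerSemicontinuous hg_lsc).preimage
      (f := fun p : E × ℝ => (p.1, (p.2 - a * ‖p.1‖ ^ 2) / l)) (by fun_prop)

variable [InnerProductSpace ℝ E]

theorem IsConvex.le_of_le (hg : IsConvex g) {x y : E} {r s t : ℝ} (ht : 0 ≤ t) (ht' : t ≤ 1)
    (hx : g x ≤ r) (hy : g y ≤ s) : g (t • x + (1 - t) • y) ≤ (t * r + (1 - t) * s : ℝ) := by
  refine (hg x y t ht ht').trans ?_
  have h1 : (t : EReal) * g x ≤ t * r := mul_le_mul_of_nonneg_left hx (by exact_mod_cast ht)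
  have h2 : ((1 - t : ℝ) : EReal) * g y ≤ (1 - t : ℝ) * s :=
    mul_le_mul_of_nonneg_left hy (by exact_mod_cast sub_nonneg.2 ht')
  push_cast at h1 h2 ⊢
  exact add_le_add h1 h2

theorem norm_convexCombination_sq (x y : E) (t : ℝ) :
    ‖t • x + (1 - t) • y‖ ^ 2 = t * ‖x‖ ^ 2 + (1 - t) * ‖y‖ ^ 2 - t * (1 - t) * ‖x - y‖ ^ 2 := by
  simp only [← real_inner_self_eq_norm_sq, inner_add_left, inner_add_right, inner_sub_left,
    inner_sub_right, real_inner_smul_left, real_inner_smul_right, real_inner_comm x y]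
  ring

theorem isStronglyConvex_quadReg (hl : 0 ≤ l) (hg : ∀ y, g y ≠ ⊥) (hg_conv : IsConvex g) :
    IsStronglyConvex a (quadReg a l g) := by
  intro x y r s t ht ht' hx hy
  rcases hl.eq_or_lt with rfl | hl
  · rw [quadReg_zero_le_iff] at hx hy ⊢
    rw [norm_convexCombination_sq]
    nlinarith [mul_le_mul_of_nonneg_left hx ht, mul_le_mul_of_nonneg_left hy (sub_nonneg.2 ht')]
  · rw [quadReg_le_iff hl hg] at hx hy ⊢
    refine (hg_conv.le_of_le ht ht' hx hy).trans ?_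
    rw [norm_convexCombination_sq]
    refine EReal.coe_le_coe_iff.2 (le_of_eq ?_)
    field_simp
    ring

theorem convex_epigraph (hg : IsConvex g) : Convex ℝ {p : E × ℝ | g p.1 ≤ p.2} := by
  rintro ⟨x, r⟩ hx ⟨y, s⟩ hy t t' ht ht' htt
  obtain rfl : t' = 1 - t := by linarith
  exact hg.le_of_le ht (by linarith) hx hy

theorem exists_affine_le (hg : IsProper g) (hg_conv : IsConvex g) (hg_lsc : LowerSemicontinuous g) :
    ∃ (φ : E →L[ℝ] ℝ) (b : ℝ), ∀ y, ((φ y + b : ℝ) : EReal) ≤ g y := by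
  obtain ⟨hbot, y₀, hy₀⟩ := hg
  lift g y₀ to ℝ using ⟨hy₀, hbot y₀⟩ with v hv
  -- One unit below the graph; this point serves both to exclude vertical hyperplanes and as the
  -- point to separate.
  have hnot : (y₀, v - 1) ∉ {p : E × ℝ | g p.1 ≤ p.2} := by
    simp only [Set.mem_ofPred_eq, ← hv, EReal.coe_le_coe_iff]
    linarith
  obtain ⟨φ, b, h, -⟩ := exists_affine_minorant (convex_epigraph hg_conv)
    (isClosed_epigraph_of_lowerSemicontinuous hg_lsc)
    (fun x r s hr hrs => le_trans (α := EReal) hr (by exact_mod_cast hrs))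
    (r₀ := v) (x₀ := y₀) (le_of_eq hv.symm) hnot hnot
  refine ⟨φ, b, fun y => ?_⟩
  rw [← EReal.le_of_forall_lt_iff_le]
  intro s hs
  exact_mod_cast h (y, s) hs.le

/-- The function `g` may be unbounded below, but no worse than affinely, and the quadratic term
dominates. Completing the square in `‖y‖` gives the constant. -/
theorem exists_lowerBound_quadReg (ha : 0 < a) (hl : 0 ≤ l) (hg : IsProper g)
    (hg_conv : IsConvex g) (hg_lsc : LowerSemicontinuous g) :
    ∃ B : ℝ, ∀ y, (B : EReal) ≤ quadReg a l g y := by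
  obtain ⟨φ, b, h⟩ := exists_affine_le hg hg_conv hg_lsc
  refine ⟨l * b - (l * ‖φ‖) ^ 2 / (4 * a), fun y => ?_⟩
  have h1 : (l : EReal) * ((φ y + b : ℝ) : EReal) ≤ l * g y :=
    mul_le_mul_of_nonneg_left (h y) (by exact_mod_cast hl)
  refine le_trans ?_ (add_le_add_right h1 _)
  norm_cast
  have h2 : -(‖φ‖ * ‖y‖) ≤ φ y := neg_le_of_abs_le (φ.le_opNorm y)
  have h3 : l * -(‖φ‖ * ‖y‖) ≤ l * φ y := mul_le_mul_of_nonneg_left h2 hl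
  have h4 : (l * ‖φ‖) ^ 2 / (4 * a) + a * ‖y‖ ^ 2 - l * ‖φ‖ * ‖y‖
      = (2 * a * ‖y‖ - l * ‖φ‖) ^ 2 / (4 * a) := by
    field_simp
    ring
  have h5 : 0 ≤ (2 * a * ‖y‖ - l * ‖φ‖) ^ 2 / (4 * a) := by positivity
  linarith

end QuadraticRegularization

/-! ### Fenchel duality in `L²` -/

section Duality

variable {Ω : Type*} [MeasurableSpace Ω] {P : Measure Ω}

theorem integral_mul_eq_inner (Y Z : Lp ℝ 2 P) : ∫ ω, Y ω * Z ω ∂P = inner ℝ Y Z := by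
  rw [L2.inner_def]
  simp [mul_comm]

theorem integral_norm_sq_eq (Y : Lp ℝ 2 P) : ∫ ω, ‖Y ω‖ ^ 2 ∂P = ‖Y‖ ^ 2 := by
  rw [← real_inner_self_eq_norm_sq, ← integral_mul_eq_inner]
  simp [pow_two]

variable {f : Lp ℝ 2 P → EReal} {C : Set (Lp ℝ 2 P)}

/-- The Fenchel–Young inequality for `f □ ι_C`. -/
theorem integral_sub_le_infConv (hf : ∀ y, f y ≠ ⊥) (X Y : Lp ℝ 2 P) :
    ((∫ ω, Y ω * X ω ∂P : ℝ) : EReal) - (conj f Y + supportFn C Y) ≤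
      infConv f (indicatorFn C) X := by
  rw [infConv_indicatorFn hf]
  refine le_iInf₂ fun Z hZ => ?_
  induction h : f (X - Z) with
  | bot => exact absurd h (hf _)
  | top => exact le_top
  | coe v =>
    have h1 : ((inner ℝ Y (X - Z) - v : ℝ) : EReal) ≤ conj f Y := by
      refine le_trans (le_of_eq ?_) (le_iSup _ (X - Z))
      rw [h, integral_mul_eq_inner, EReal.coe_sub]
    have h2 : ((inner ℝ Y Z : ℝ) : EReal) ≤ supportFn C Y := by
      rw [← integral_mul_eq_inner]
      exact le_iSup₂ (f := fun (W : Lp ℝ 2 P) (_ : W ∈ C) =>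
        ((∫ ω, Y ω * W ω ∂P : ℝ) : EReal)) Z hZ
    refine (EReal.sub_le_sub le_rfl (add_le_add h1 h2)).trans ?_
    rw [integral_mul_eq_inner, inner_sub_right]
    norm_cast
    linarith

/-- The joint supremum over `y` and `z ∈ C` splits into the conjugate and the support function. -/
theorem conj_add_supportFn_le {Y : Lp ℝ 2 P} {b r₀ : ℝ} {y₀ : Lp ℝ 2 P} (hf : ∀ y, f y ≠ ⊥)
    (hy₀ : f y₀ ≤ r₀) (hC : C.Nonempty)
    (h : ∀ y, ∀ z ∈ C, ∀ r : ℝ, f y ≤ r → inner ℝ Y (y + z) + b ≤ r) :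
    conj f Y + supportFn C Y ≤ (-b : ℝ) := by
  have h1 : ∀ z ∈ C, conj f Y ≤ (-b - inner ℝ Y z : ℝ) := by
    refine fun z hz => iSup_le fun y => ?_
    induction hv : f y with
    | bot => exact absurd hv (hf y)
    | top => simp
    | coe v =>
      have := h y z hz v hv.le
      rw [inner_add_right] at this
      rw [integral_mul_eq_inner]
      norm_cast
      linarith
  have h2 : ((inner ℝ Y y₀ - r₀ : ℝ) : EReal) ≤ conj f Y := by
    refine le_trans ?_ (le_iSup _ y₀)
    rw [integral_mul_eq_inner, EReal.coe_sub]
    exact EReal.sub_le_sub le_rfl hy₀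
  obtain ⟨z₀, hz₀⟩ := hC
  -- Finiteness of the conjugate, from one point of `C` and one finite value of `f`, permits
  -- subtracting it in the bound on the support function.
  have htop : conj f Y ≠ ⊤ := ((h1 z₀ hz₀).trans_lt (EReal.coe_lt_top _)).ne
  have hbot : conj f Y ≠ ⊥ := ((EReal.bot_lt_coe _).trans_le h2).ne'
  lift conj f Y to ℝ using ⟨htop, hbot⟩ with κ
  have h3 : supportFn C Y ≤ (-b - κ : ℝ) := by
    refine iSup₂_le fun z hz => ?_
    have := h1 z hz
    rw [integral_mul_eq_inner]
    norm_cast at this ⊢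
    linarith
  refine (add_le_add_right h3 _).trans (le_of_eq ?_)
  norm_cast
  ring

/-- The point `(X, c)` lies off the closed sum epigraph, so an affine minorant passes above it; the
Riesz vector of its slope is `Y`. -/
theorem exists_lt_integral_sub {a B : ℝ} (ha : 0 ≤ a) (hf : IsStronglyConvex a f)
    (hclosed : IsClosed (sumEpigraph f C)) (hB : ∀ y, (B : EReal) ≤ f y)
    {y₀ : Lp ℝ 2 P} {r₀ : ℝ} (hy₀ : f y₀ ≤ r₀) (hC : Convex ℝ C) (hCne : C.Nonempty)
    {X : Lp ℝ 2 P} {c : ℝ} (hc : (c : EReal) < infConv f (indicatorFn C) X) :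
    ∃ Y : Lp ℝ 2 P,
      (c : EReal) < ((∫ ω, Y ω * X ω ∂P : ℝ) : EReal) - (conj f Y + supportFn C Y) := by
  have hbot : ∀ y, f y ≠ ⊥ := fun y => ((EReal.bot_lt_coe _).trans_le (hB y)).ne'
  obtain ⟨z₀, hz₀⟩ := hCne
  have h₀ : (y₀ + z₀, r₀) ∈ sumEpigraph f C := ⟨y₀, by simpa using hz₀, hy₀⟩
  have hc₀ : (y₀ + z₀, B - 1) ∉ sumEpigraph f C := by
    rintro ⟨y, -, hy⟩
    have : B ≤ B - 1 := by exact_mod_cast (hB y).trans hy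
    linarith
  have hXc : (X, c) ∉ sumEpigraph f C := by
    rintro ⟨y, hyC, hy⟩
    rw [infConv_indicatorFn hbot] at hc
    have h := hc.trans_le (iInf₂_le (X - y) hyC)
    rw [sub_sub_cancel] at h
    exact absurd hy h.not_ge
  obtain ⟨φ, b, hφ, hφX⟩ := exists_affine_minorant (convex_sumEpigraph ha hf hC) hclosed
    (fun _ _ _ => sumEpigraph_mono) h₀ hc₀ hXc
  set Y := (InnerProductSpace.toDual ℝ (Lp ℝ 2 P)).symm φ with hY
  have hinner : ∀ y, inner ℝ Y y = φ y := fun y => InnerProductSpace.toDual_symm_apply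
  refine ⟨Y, ?_⟩
  have hle : conj f Y + supportFn C Y ≤ (-b : ℝ) := by
    refine conj_add_supportFn_le hbot hy₀ ⟨z₀, hz₀⟩ fun y z hz r hr => ?_
    rw [hinner]
    exact hφ (y + z, r) ⟨y, by simpa using hz, hr⟩
  refine lt_of_lt_of_le ?_ (EReal.sub_le_sub le_rfl hle)
  rw [integral_mul_eq_inner, hinner]
  norm_cast
  linarith

/-- Strong duality for `f □ ι_C` with `f` strongly convex. -/
theorem infConv_eq_iSup {a B : ℝ} (ha : 0 ≤ a) (hf : IsStronglyConvex a f)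
    (hclosed : IsClosed (sumEpigraph f C)) (hB : ∀ y, (B : EReal) ≤ f y)
    {y₀ : Lp ℝ 2 P} {r₀ : ℝ} (hy₀ : f y₀ ≤ r₀) (hC : Convex ℝ C) (hCne : C.Nonempty)
    (X : Lp ℝ 2 P) :
    infConv f (indicatorFn C) X =
      ⨆ Y : Lp ℝ 2 P, ((∫ ω, Y ω * X ω ∂P : ℝ) : EReal) - (conj f Y + supportFn C Y) := by
  refine le_antisymm ?_ (iSup_le (integral_sub_le_infConv
    (fun y => ((EReal.bot_lt_coe _).trans_le (hB y)).ne') X))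
  rw [← EReal.ge_of_forall_gt_iff_ge]
  intro c hc
  obtain ⟨Y, hY⟩ := exists_lt_integral_sub ha hf hclosed hB hy₀ hC hCne hc
  exact hY.le.trans (le_iSup (fun Y : Lp ℝ 2 P =>
    ((∫ ω, Y ω * X ω ∂P : ℝ) : EReal) - (conj f Y + supportFn C Y)) Y)

/-- When `X` does not vanish, `V ↦ V / X` identifies the alternative models of `X` with `L²`. -/
theorem iSup_altModels {X : Lp ℝ 2 P} (hX : ∀ᵐ ω ∂P, X ω ≠ 0) (F : Lp ℝ 2 P → EReal) :
    ⨆ V : altModels X, ((∫ ω, (V : Ω → ℝ) ω ∂P : ℝ) : EReal) - F (altModels.ratio V) =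
      ⨆ Y : Lp ℝ 2 P, ((∫ ω, Y ω * X ω ∂P : ℝ) : EReal) - F Y := by
  have key : ∀ (V : altModels X) (Y : Lp ℝ 2 P), (V : Ω → ℝ) =ᵐ[P] (fun ω => Y ω * X ω) →
      ((∫ ω, (V : Ω → ℝ) ω ∂P : ℝ) : EReal) - F (altModels.ratio V) =
        ((∫ ω, Y ω * X ω ∂P : ℝ) : EReal) - F Y := by
    intro V Y hV
    have hratio : altModels.ratio V = Y := by
      refine Lp.ext ((MemLp.coeFn_toLp (altModels.memLp_ratio V.2)).trans ?_)
      filter_upwards [hV, hX] with ω h1 h2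
      rw [h1, mul_div_cancel_right₀ _ h2]
    rw [hratio, integral_congr_ae hV]
  refine le_antisymm (iSup_le fun V => ?_) (iSup_le fun Y => ?_)
  · obtain ⟨Y, hY⟩ := V.2
    rw [key V Y hY]
    exact le_iSup (fun Y : Lp ℝ 2 P => ((∫ ω, Y ω * X ω ∂P : ℝ) : EReal) - F Y) Y
  · rw [← key ⟨fun ω => Y ω * X ω, Y, ae_eq_rfl⟩ Y ae_eq_rfl]
    exact le_iSup (fun V : altModels X =>
      ((∫ ω, (V : Ω → ℝ) ω ∂P : ℝ) : EReal) - F (altModels.ratio V)) _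

end Duality

/-! ### Risk-perspectives as instances of the abstract setting -/

namespace RiskPerspective

variable {Ω : Type*} [MeasurableSpace Ω] {P : Measure Ω} [IsFiniteMeasure P]
  (R : RiskPerspective P)

theorem loss_eq_quadReg (lam : ℝ) :
    R.loss lam = quadReg (1 - lam) lam (fun Z => R.ρ (R.u Z)) := by
  funext Y
  rw [loss, quadReg, integral_norm_sq_eq]

theorem estimators_nonempty : R.estimators.Nonempty :=
  R.feasible.mono fun _ h => h.1.1

theorem convex_estimators : Convex ℝ R.estimators :=
  (lpMeas ℝ ℝ R.G.1 2 P).convex.inter R.feature_convex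

theorem isClosed_estimators : IsClosed R.estimators :=
  (isClosed_aestronglyMeasurable R.G.2).inter R.feature_closed

end RiskPerspective

end RobustRep

theorem mainTheorem7 {Ω : Type*} [MeasurableSpace Ω] (P : Measure Ω) [IsProbabilityMeasure P]
    (R : RiskPerspective P) (lam : ℝ) (hlam0 : 0 ≤ lam) (hlam1 : lam < 1)
    (Xt : Lp ℝ 2 P) (hXt : ∀ᵐ ω ∂P, Xt ω ≠ 0)
    (hreg : (0 : Lp ℝ 2 P) ∈
      sri (dom (R.loss lam) + dom (indicatorFn R.estimators))) :
    (∃ Z, R.IsConditioning lam Xt Z) ∧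
    ∀ Z, R.IsConditioning lam Xt Z →
      R.loss lam (Xt - Z) = infConv (R.loss lam) (indicatorFn R.estimators) Xt ∧
      R.loss lam (Xt - Z) =
        ⨆ V : altModels Xt,
          ((∫ ω, (V : Ω → ℝ) ω ∂P : ℝ) : EReal) - R.penalty lam (altModels.ratio V) := by
  have ha : 0 < 1 - lam := sub_pos.2 hlam1
  have hloss := R.loss_eq_quadReg lam
  obtain ⟨B, hB⟩ := exists_lowerBound_quadReg ha hlam0 R.utility_proper R.utility_convex
    R.utility_lsc
  obtain ⟨y₀, r₀, hy₀⟩ := exists_quadReg_le (a := 1 - lam) (l := lam) R.utility_proper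
  have hconv := isStronglyConvex_quadReg (a := 1 - lam) hlam0 R.utility_proper.1 R.utility_convex
  have hepi := isClosed_epigraph_quadReg (a := 1 - lam) hlam0 R.utility_proper.1 R.utility_lsc
  rw [← hloss] at hB hy₀ hconv hepi
  have hclosed := isClosed_sumEpigraph ha hconv hepi hB R.convex_estimators R.isClosed_estimators
  refine ⟨exists_minimizer hclosed hB R.estimators_nonempty Xt, fun Z hZ => ?_⟩
  have h := infConv_eq_of_isMinimizer
    (fun y => ((EReal.bot_lt_coe _).trans_le (hB y)).ne') hZ.1 hZ.2
  refine ⟨h, h.trans ?_⟩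
  rw [iSup_altModels hXt (R.penalty lam)]
  exact infConv_eq_iSup ha.le hconv hclosed hB hy₀ R.convex_estimators R.estimators_nonempty Xt
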